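/- A latin bitrade is a pair $T=(T^*,T^\triangle)$ of disjoint finite sets of triples (row, column, symbol) such that for all distinct $r,s\in\{1,2,3\}$ each triple of $T^*$ agrees in coordinates $r$ and $s$ with exactly one triple of $T^\triangle$, and conversely. Row, column and symbol labels are regarded as pairwise different objects. $T$ is spherical if it is not a disjoint union of two latin bitrades that are both nonempty and if the total number of its rows, columns and symbols equals $|T^*|+2$. For $a=(a_1,a_2,a_3)\in T^*$ let $\mathrm{Eq}(T,a)$ be the system of linear equations, with the rows, columns and symbols as unknowns, consisting of $a_1=0$, $a_2=0$, $a_3=1$ and of $b_1+b_2=b_3$ for all $b=(b_1,b_2,b_3)\in T^*\setminus\{a\}$. A rational solution $x\mapsto\bar x$ is separated if $\bar b_i=\bar d_i$ implies $b_i=d_i$ for all $b,d\in T^*$ and $i\in\{1,2,3\}$. **Theorem 2.1.** Let $T$ be a spherical latin bitrade and $a\in T^*$, and suppose that $\mathrm{Eq}(T,a)$ has a separated rational solution $x\mapsto\bar x$. Then this is the only rational solution of $\mathrm{Eq}(T,a)$. For $c\in T^\triangle$ let $\Delta(c,a)$ be the triangle bounded by the lines $y=\bar c_1$, $x=\bar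 c_2$ and $x+y=\bar c_3$. The triangles $\Delta(c,a)$, $c\in T^\triangle$, are pairwise distinct and dissect the triangle $\Sigma=\{(x,y): x\ge 0,\ y\ge 0,\ x+y\le 1\}$: there is more than one of them, each is nondegenerate with sides parallel to those of $\Sigma$, their interiors are pairwise disjoint, and their union is $\Sigma$. This dissection is separated: no point is a vertex of exactly six of the triangles, and for every line $p$ containing a side of one of the triangles, the union of all sides of the triangles that lie on $p$ is a single contiguous segment. -/

import Mathlib

/-- A (finite) latin bitrade: a pair `(star, tri)` of disjoint finite sets of triples such that every
triple of either set agrees in each two prescribed coordinates with exactly one triple of the other.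
Coordinates `0`, `1`, `2` are the row, the column and the symbol. Labels at different coordinates are
always regarded as different objects, even when they are the same element of `X`. -/
structure LatinBitrade (X : Type*) where
  star : Finset (Fin 3 → X)
  tri : Finset (Fin 3 → X)
  disj : Disjoint star tri
  star_tri : ∀ p ∈ star, ∀ r s : Fin 3, r ≠ s → ∃! q, q ∈ tri ∧ p r = q r ∧ p s = q s
  tri_star : ∀ q ∈ tri, ∀ r s : Fin 3, r ≠ s → ∃! p, p ∈ star ∧ q r = p r ∧ q s = p s

namespace LatinBitrade

variable {X : Type*}

/-- The bitrade is not a disjoint union of two nonempty latin bitrades. -/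
def Indecomposable (T : LatinBitrade X) : Prop :=
  ¬ ∃ U V : LatinBitrade X, U.star.Nonempty ∧ V.star.Nonempty ∧
    Disjoint U.star V.star ∧ Disjoint U.tri V.tri ∧
    (T.star : Set (Fin 3 → X)) = (U.star : Set (Fin 3 → X)) ∪ (V.star : Set (Fin 3 → X)) ∧
    (T.tri : Set (Fin 3 → X)) = (U.tri : Set (Fin 3 → X)) ∪ (V.tri : Set (Fin 3 → X))

/-- The number of different rows (`i = 0`), columns (`i = 1`) or symbols (`i = 2`). -/
noncomputable def order (T : LatinBitrade X) (i : Fin 3) : ℕ :=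
  ((fun b : Fin 3 → X => b i) '' (T.star : Set (Fin 3 → X))).ncard

/-- Spherical: indecomposable, and the aggregate number of rows, columns and symbols is the size
plus two. -/
def Spherical (T : LatinBitrade X) : Prop :=
  T.Indecomposable ∧ T.order 0 + T.order 1 + T.order 2 = T.star.card + 2

/-- `v` solves the system `Eq(T,a)`: the unknown belonging to the label `x` at coordinate `i` has
the value `v i x`; the unknowns `a 0`, `a 1`, `a 2` are given the values `0`, `0`, `1`, and each
triple `b ≠ a` of `star` gives the equation `b 0 + b 1 = b 2`. -/
def IsSolution (T : LatinBitrade X) (a : Fin 3 → X) (v : Fin 3 → X → ℚ) : Prop :=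
  v 0 (a 0) = 0 ∧ v 1 (a 1) = 0 ∧ v 2 (a 2) = 1 ∧
    ∀ b ∈ T.star, b ≠ a → v 0 (b 0) + v 1 (b 1) = v 2 (b 2)

/-- Different rows (columns, symbols) have different values. -/
def IsSeparatedSolution (T : LatinBitrade X) (v : Fin 3 → X → ℚ) : Prop :=
  ∀ b ∈ T.star, ∀ d ∈ T.star, ∀ i : Fin 3, v i (b i) = v i (d i) ↔ b i = d i

end LatinBitrade

namespace TriangleDissection

/-- The triangle `Σ`. -/
def bigTriangle : Set (ℝ × ℝ) := {p | 0 ≤ p.1 ∧ 0 ≤ p.2 ∧ p.1 + p.2 ≤ 1}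

/-- The line `y = t`. -/
def rowLine (t : ℝ) : Set (ℝ × ℝ) := {p | p.2 = t}

/-- The line `x = t`. -/
def columnLine (t : ℝ) : Set (ℝ × ℝ) := {p | p.1 = t}

/-- The line `x + y = t`. -/
def symbolLine (t : ℝ) : Set (ℝ × ℝ) := {p | p.1 + p.2 = t}

/-- The triangle bounded by three pairwise nonparallel lines: the convex hull of their pairwise
intersections (a single point if the lines are concurrent). -/
def triangleOfLines (k l m : Set (ℝ × ℝ)) : Set (ℝ × ℝ) :=
  convexHull ℝ ((k ∩ l) ∪ (k ∩ m) ∪ (l ∩ m))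

/-- `Δ(c,a)`, where `v` is the solution of `Eq(T,a)`. -/
def cellTriangle {X : Type*} (v : Fin 3 → X → ℚ) (c : Fin 3 → X) : Set (ℝ × ℝ) :=
  triangleOfLines (rowLine (v 0 (c 0) : ℚ)) (columnLine (v 1 (c 1) : ℚ))
    (symbolLine (v 2 (c 2) : ℚ))

/-- `D` is a (nontrivial) dissection of the nondegenerate triangle `S`: `D` is a finite set, with
more than one element, of nondegenerate triangles with pairwise disjoint interiors and with union
`S`. The triangles are homothetic to `S` (with a positive or a negative ratio, or translates of
`S`); in other words an affine map that makes `S` equilateral makes them equilateral, with sides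
parallel to those of `S`. -/
structure IsDissection (S : Set (ℝ × ℝ)) (D : Set (Set (ℝ × ℝ))) : Prop where
  finite : D.Finite
  nontrivial : D.Nontrivial
  homothetic : ∀ Δ ∈ D, ∃ (k : ℝ) (w : ℝ × ℝ), k ≠ 0 ∧ Δ = (fun p => k • p + w) '' S
  disjoint_interior : ∀ Δ ∈ D, ∀ Δ' ∈ D, Δ ≠ Δ' → Disjoint (interior Δ) (interior Δ')
  union : ⋃₀ D = S

/-- The sides of a triangle; its vertices are its extreme points. -/
def sides (Δ : Set (ℝ × ℝ)) : Set (Set (ℝ × ℝ)) :=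
  {s | ∃ p ∈ Δ.extremePoints ℝ, ∃ q ∈ Δ.extremePoints ℝ, p ≠ q ∧ s = segment ℝ p q}

/-- The union of all sides of triangles of `D` that induce the line `l`. -/
def sidesOn (D : Set (Set (ℝ × ℝ))) (l : AffineSubspace ℝ (ℝ × ℝ)) : Set (ℝ × ℝ) :=
  ⋃₀ {s | ∃ Δ ∈ D, s ∈ sides Δ ∧ affineSpan ℝ s = l}

/-- The separation property of a dissection: no point is a vertex of six triangles, and on each line
induced by a side of a triangle the sides inducing that line form one contiguous segment. -/
structure IsSeparated (D : Set (Set (ℝ × ℝ))) : Prop where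
  valence : ∀ P : ℝ × ℝ, {Δ | Δ ∈ D ∧ P ∈ Δ.extremePoints ℝ}.ncard ≠ 6
  contiguous : ∀ Δ ∈ D, ∀ s ∈ sides Δ, ∃ p q : ℝ × ℝ,
    sidesOn D (affineSpan ℝ s) = segment ℝ p q

end TriangleDissection

/-! A quantity that depends on only two coordinates has the same sum over both mates
(`sum_star_eq_sum_tri`). Hence so does every polynomial whose monomials each involve at most two
coordinates; degree two is all that is needed.

Uniqueness: for a solution of the homogeneous system, the squared triple sums add up to zero over
`star`, hence over `tri`. The equation thus holds on both mates, zeros spread between neighbouring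
triples, and indecomposability makes everything vanish (`Indecomposable.eq_zero`).

Dissection: in barycentric coordinates, for a point off all lines, membership in the triangle of a
triple is a quadratic polynomial in the three indicators of the sides of the lines on which the
point lies (`indicator_cell`). Over `star` only `a` contributes, since the other triples have
concurrent lines. So a generic point lies in exactly one cell if it is in the big triangle and in
none otherwise; density does the rest.

Separation: a vertex of given orientation determines its triple, so at most three cells share a
vertex. A gap between the sides on a line would split the triples of one label into two closed
classes. Treating these as two labels gives one unknown too many for the trivial kernel of the
homogeneous system, by the spherical count (`Spherical.cycle_trivial`). The lines of `a` are handled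
by a signed count of sides. -/

theorem Fin.exists_third {i j : Fin 3} (h : i ≠ j) :
    ∃ k, k ≠ i ∧ k ≠ j ∧ (∀ l, l = i ∨ l = j ∨ l = k) := by
  revert i j
  decide

theorem Fin.sum_univ_three_of_ne {M : Type*} [AddCommMonoid M] (f : Fin 3 → M) {i j k : Fin 3}
    (hij : i ≠ j) (hki : k ≠ i) (hkj : k ≠ j) : ∑ l, f l = f i + f j + f k := by
  have h : (Finset.univ : Finset (Fin 3)) = {i, j, k} := by
    revert i j k
    decide
  rw [h, Finset.sum_insert, Finset.sum_insert, Finset.sum_singleton, add_assoc]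
  · simpa using hkj.symm
  · simpa using ⟨hij, hki.symm⟩

/-! ### Double counting and linear algebra on bitrades -/

namespace LatinBitrade

variable {X : Type*} (T : LatinBitrade X)

theorem exists_star {c : Fin 3 → X} (hc : c ∈ T.tri) {i j : Fin 3} (hij : i ≠ j) :
    ∃ b ∈ T.star, b i = c i ∧ b j = c j := by
  obtain ⟨b, ⟨hb, h1, h2⟩, -⟩ := T.tri_star c hc i j hij
  exact ⟨b, hb, h1.symm, h2.symm⟩

theorem exists_tri {b : Fin 3 → X} (hb : b ∈ T.star) {i j : Fin 3} (hij : i ≠ j) :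
    ∃ c ∈ T.tri, b i = c i ∧ b j = c j := by
  obtain ⟨c, ⟨hc, h1, h2⟩, -⟩ := T.star_tri b hb i j hij
  exact ⟨c, hc, h1, h2⟩

theorem tri_unique {c d : Fin 3 → X} (hc : c ∈ T.tri) (hd : d ∈ T.tri) {i j : Fin 3} (hij : i ≠ j)
    (h1 : c i = d i) (h2 : c j = d j) : c = d := by
  obtain ⟨b, hb, h3, h4⟩ := T.exists_star hc hij
  exact (T.star_tri b hb i j hij).unique ⟨hc, h3, h4⟩ ⟨hd, h3.trans h1, h4.trans h2⟩

theorem star_unique {b d : Fin 3 → X} (hb : b ∈ T.star) (hd : d ∈ T.star) {i j : Fin 3}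
    (hij : i ≠ j) (h1 : b i = d i) (h2 : b j = d j) : b = d := by
  obtain ⟨c, hc, h3, h4⟩ := T.exists_tri hb hij
  exact (T.tri_star c hc i j hij).unique ⟨hb, h3.symm, h4.symm⟩
    ⟨hd, h3.symm.trans h1, h4.symm.trans h2⟩

/-- A quantity that depends on two coordinates only has the same sum over both mates. -/
theorem sum_star_eq_sum_tri {M : Type*} [AddCommMonoid M] {i j : Fin 3} (hij : i ≠ j)
    (g : (Fin 3 → X) → M)
    (hg : ∀ b ∈ T.star, ∀ c ∈ T.tri, b i = c i → b j = c j → g b = g c) :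
    ∑ b ∈ T.star, g b = ∑ c ∈ T.tri, g c := by
  choose! φ hφ h1 h2 using fun b (hb : b ∈ T.star) => T.exists_tri hb hij
  refine Finset.sum_bij (fun b _ => φ b) hφ ?_ ?_ ?_
  · intro b hb d hd h
    exact T.star_unique hb hd hij ((h1 b hb).trans (by rw [h, h1 d hd]))
      ((h2 b hb).trans (by rw [h, h2 d hd]))
  · intro c hc
    obtain ⟨b, hb, h3, h4⟩ := T.exists_star hc hij
    exact ⟨b, hb, T.tri_unique (hφ b hb) hc hij ((h1 b hb).symm.trans h3)
      ((h2 b hb).symm.trans h4)⟩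
  · exact fun b hb => hg b hb _ (hφ b hb) (h1 b hb) (h2 b hb)

/-- `f i` is compatible if it takes the same value on two triples from different mates that agree in
coordinate `i` and in one more coordinate. -/
def Compatible {K : Type*} (f : Fin 3 → (Fin 3 → X) → K) : Prop :=
  ∀ i j : Fin 3, i ≠ j → ∀ b ∈ T.star, ∀ c ∈ T.tri, b i = c i → b j = c j → f i b = f i c

variable {T}

theorem Compatible.sum_star_single {K : Type*} {f : Fin 3 → (Fin 3 → X) → K} (hf : T.Compatible f)
    {M : Type*} [AddCommMonoid M] (φ : K → M) (i : Fin 3) :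
    ∑ b ∈ T.star, φ (f i b) = ∑ c ∈ T.tri, φ (f i c) := by
  have h : i ≠ i + 1 := by revert i; decide
  exact T.sum_star_eq_sum_tri h _ fun b hb c hc h1 h2 => by rw [hf i _ h b hb c hc h1 h2]

theorem Compatible.sum_star_mul {K : Type*} [Mul K] [AddCommMonoid K]
    {f : Fin 3 → (Fin 3 → X) → K} (hf : T.Compatible f) {i j : Fin 3} (h : i ≠ j) :
    ∑ b ∈ T.star, f i b * f j b = ∑ c ∈ T.tri, f i c * f j c :=
  T.sum_star_eq_sum_tri h _ fun b hb c hc h1 h2 => by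
    rw [hf i j h b hb c hc h1 h2, hf j i h.symm b hb c hc h2 h1]

theorem card_star_eq_card_tri : T.star.card = T.tri.card := by
  rw [Finset.card_eq_sum_ones, Finset.card_eq_sum_ones]
  exact T.sum_star_eq_sum_tri (i := 0) (j := 1) (by decide) _ fun _ _ _ _ _ _ => rfl

/-- A property that passes between triples of the two mates agreeing in two coordinates holds for
all triples as soon as it holds for one. -/
theorem Indecomposable.forall_of_exists (hT : T.Indecomposable) (P : (Fin 3 → X) → Prop)
    (hP : ∀ i j : Fin 3, i ≠ j → ∀ b ∈ T.star, ∀ c ∈ T.tri, b i = c i → b j = c j → (P b ↔ P c))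
    {a : Fin 3 → X} (ha : a ∈ T.star) (hPa : P a) : ∀ b ∈ T.star, P b := by
  classical
  by_contra! h
  obtain ⟨b, hb, hPb⟩ := h
  -- Filtering both mates by a property that passes between neighbours leaves a bitrade.
  have sub : ∀ Q : (Fin 3 → X) → Prop,
      (∀ i j : Fin 3, i ≠ j → ∀ b ∈ T.star, ∀ c ∈ T.tri, b i = c i → b j = c j → (Q b ↔ Q c)) →
      ∃ U : LatinBitrade X, U.star = T.star.filter Q ∧ U.tri = T.tri.filter Q := by
    intro Q hQ
    refine ⟨⟨T.star.filter Q, T.tri.filter Q, ?_, ?_, ?_⟩, rfl, rfl⟩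
    · exact T.disj.mono (Finset.filter_subset _ _) (Finset.filter_subset _ _)
    · intro p hp r s hrs
      rw [Finset.mem_filter] at hp
      obtain ⟨q, hq, h1, h2⟩ := T.exists_tri hp.1 hrs
      refine ⟨q, ⟨Finset.mem_filter.2 ⟨hq, (hQ r s hrs p hp.1 q hq h1 h2).1 hp.2⟩, h1, h2⟩, ?_⟩
      rintro q' ⟨hq', h3, h4⟩
      exact T.tri_unique (Finset.mem_filter.1 hq').1 hq hrs (h3.symm.trans h1) (h4.symm.trans h2)
    · intro q hq r s hrs
      rw [Finset.mem_filter] at hq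
      obtain ⟨p, hp, h1, h2⟩ := T.exists_star hq.1 hrs
      refine ⟨p, ⟨Finset.mem_filter.2 ⟨hp, (hQ r s hrs p hp q hq.1 h1 h2).2 hq.2⟩,
        h1.symm, h2.symm⟩, ?_⟩
      rintro p' ⟨hp', h3, h4⟩
      exact T.star_unique (Finset.mem_filter.1 hp').1 hp hrs (h3.symm.trans h1.symm)
        (h4.symm.trans h2.symm)
  obtain ⟨U, hU1, hU2⟩ := sub P hP
  obtain ⟨V, hV1, hV2⟩ := sub (fun b => ¬ P b)
    fun i j hij b hb c hc h1 h2 => not_congr (hP i j hij b hb c hc h1 h2)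
  refine hT ⟨U, V, ?_, ?_, ?_, ?_, ?_, ?_⟩
  · exact ⟨a, by simp [hU1, ha, hPa]⟩
  · exact ⟨b, by simp [hV1, hb, hPb]⟩
  · rw [hU1, hV1]; simp +contextual [Finset.disjoint_left]
  · rw [hU2, hV2]; simp +contextual [Finset.disjoint_left]
  · rw [hU1, hV1, ← Finset.coe_union, Finset.filter_union_filter_not_eq]
  · rw [hU2, hV2, ← Finset.coe_union, Finset.filter_union_filter_not_eq]

/-- The homogeneous system of an indecomposable bitrade, with unknowns that are only required to be
compatible, has the trivial solution only. -/
theorem Indecomposable.eq_zero (hT : T.Indecomposable) {f : Fin 3 → (Fin 3 → X) → ℚ}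
    (hf : T.Compatible f) {a : Fin 3 → X} (ha : a ∈ T.star) (hfa : ∀ i, f i a = 0)
    (hsum : ∀ b ∈ T.star, ∑ i, f i b = 0) : ∀ b ∈ T.star, ∀ i, f i b = 0 := by
  have hsq : ∑ c ∈ T.tri, (∑ i, f i c) ^ 2 = 0 := by
    -- Every monomial of the expanded square involves at most two coordinates.
    have key : ∑ b ∈ T.star, (∑ i, f i b) ^ 2 = ∑ c ∈ T.tri, (∑ i, f i c) ^ 2 := by
      have expand : ∀ b, (∑ i, f i b) ^ 2 = f 0 b ^ 2 + f 1 b ^ 2 + f 2 b ^ 2 +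
          2 * (f 0 b * f 1 b) + 2 * (f 0 b * f 2 b) + 2 * (f 1 b * f 2 b) := by
        intro b
        rw [Fin.sum_univ_three]
        ring
      simp only [expand, Finset.sum_add_distrib, ← Finset.mul_sum]
      rw [hf.sum_star_single (· ^ 2) 0, hf.sum_star_single (· ^ 2) 1, hf.sum_star_single (· ^ 2) 2,
        hf.sum_star_mul (i := 0) (j := 1) (by decide), hf.sum_star_mul (i := 0) (j := 2) (by decide),
        hf.sum_star_mul (i := 1) (j := 2) (by decide)]
    rw [← key]
    exact Finset.sum_eq_zero fun b hb => by rw [hsum b hb]; norm_num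
  have htri : ∀ c ∈ T.tri, ∑ i, f i c = 0 := by
    intro c hc
    have := (Finset.sum_eq_zero_iff_of_nonneg (fun c _ => sq_nonneg (∑ i, f i c))).1 hsq c hc
    exact pow_eq_zero_iff (two_ne_zero) |>.1 this
  refine hT.forall_of_exists (fun b => ∀ i, f i b = 0) ?_ ha hfa
  intro i j hij b hb c hc h1 h2
  obtain ⟨k, hki, hkj, hk⟩ := Fin.exists_third hij
  have e1 := hf i j hij b hb c hc h1 h2
  have e2 := hf j i hij.symm b hb c hc h2 h1
  have e3 := hsum b hb
  have e4 := htri c hc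
  rw [Fin.sum_univ_three_of_ne _ hij hki hkj] at e3 e4
  -- The sum vanishes on both triples, so agreement in two coordinates forces it in the third.
  have e5 : f k b = f k c := by linarith
  have : ∀ l, f l b = f l c := by
    intro l
    rcases hk l with rfl | rfl | rfl <;> assumption
  simp [this]

/-- In a spherical bitrade the triples of a row (column, symbol) form a single cycle: a set of such
triples closed under passing to the other mate and back is trivial. -/
theorem Spherical.cycle_trivial (hT : T.Spherical) {a : Fin 3 → X} (ha : a ∈ T.star) (i : Fin 3)
    (A : (Fin 3 → X) → Prop)
    (hA : ∀ j, i ≠ j → ∀ b ∈ T.star, ∀ c ∈ T.tri, b i = c i → b j = c j → (A b ↔ A c))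
    {b₁ b₂ : Fin 3 → X} (hb₁ : b₁ ∈ T.star) (hb₂ : b₂ ∈ T.star) (h12 : b₁ i = b₂ i)
    (hA₁ : A b₁) (hA₂ : ¬ A b₂) : False := by
  classical
  let lab (j : Fin 3) : Set X := (fun b : Fin 3 → X => b j) '' (T.star : Set (Fin 3 → X))
  have hfin (j : Fin 3) : (lab j).Finite := T.star.finite_toSet.image _
  have : ∀ j, Fintype (lab j) := fun j => (hfin j).fintype
  let W := ((Σ j, lab j) → ℚ) × ℚ
  let ext (j : Fin 3) (x : X) : ((Σ j, lab j) → ℚ) →ₗ[ℚ] ℚ :=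
    if h : x ∈ lab j then LinearMap.proj ⟨j, x, h⟩ else 0
  -- The extra unknown `w.2` is added to the label at coordinate `i` on the triples in `A`, as if
  -- each such label were split in two.
  let F (j : Fin 3) (b : Fin 3 → X) : W →ₗ[ℚ] ℚ :=
    ext j (b j) ∘ₗ LinearMap.fst ℚ _ _ + if j = i ∧ A b then LinearMap.snd ℚ _ _ else 0
  -- One equation for every triple, `a` included, and two normalizations at `a`; the third value at
  -- `a` then vanishes by the equation of `a`. With |T*| + 3 unknowns and |T*| + 2 equations the
  -- kernel is nontrivial.
  let L : W →ₗ[ℚ] (T.star → ℚ) × (ℚ × ℚ) :=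
    (LinearMap.pi fun b : T.star => ∑ j, F j b.1).prod ((F 0 a).prod (F 1 a))
  have hker : LinearMap.ker L ≠ ⊥ := by
    apply LinearMap.ker_ne_bot_of_finrank_lt
    have h1 : Module.finrank ℚ W = T.order 0 + T.order 1 + T.order 2 + 1 := by
      have hc (j : Fin 3) : Fintype.card (lab j) = T.order j := by
        rw [← Nat.card_eq_fintype_card, Nat.card_coe_set_eq]; rfl
      simp only [W, Module.finrank_prod, Module.finrank_fintype_fun_eq_card, Module.finrank_self,
        Fintype.card_sigma, Fin.sum_univ_three, hc]
    rw [h1, hT.2]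
    simp [Module.finrank_prod]
  obtain ⟨w, hw, hw0⟩ := Submodule.exists_mem_ne_zero_of_ne_bot hker
  have hL : L w = 0 := hw
  have hsum : ∀ b ∈ T.star, ∑ j, F j b w = 0 := by
    intro b hb
    have := congrFun (congrArg Prod.fst hL) ⟨b, hb⟩
    simpa [L] using this
  have h0 : F 0 a w = 0 := congrArg (fun z => z.2.1) hL
  have h1 : F 1 a w = 0 := congrArg (fun z => z.2.2) hL
  have hcomp : T.Compatible fun j b => F j b w := by
    intro j k hjk b hb c hc e1 e2
    have : (j = i ∧ A b) ↔ (j = i ∧ A c) :=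
      and_congr_right fun h => by subst h; exact hA k hjk b hb c hc e1 e2
    simp only [F, e1, this]
  have hzero := hT.1.eq_zero hcomp ha (by
    have h2 := hsum a ha
    rw [Fin.sum_univ_three, h0, h1] at h2
    intro j
    fin_cases j
    · exact h0
    · exact h1
    · simpa using h2) hsum
  have ext_apply (j : Fin 3) (b : Fin 3 → X) (hb : b ∈ T.star) :
      ext j (b j) w.1 = w.1 ⟨j, b j, b, hb, rfl⟩ := by
    have : b j ∈ lab j := ⟨b, hb, rfl⟩
    simp only [ext, dif_pos this, LinearMap.proj_apply]
  -- These two values share a label and differ exactly by `w.2`.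
  have hF1 := hzero b₁ hb₁ i
  have hF2 := hzero b₂ hb₂ i
  simp only [F, hA₁, hA₂, h12, and_true, and_false, if_true, if_false, LinearMap.add_apply,
    LinearMap.comp_apply, add_zero] at hF1 hF2
  have hw2 : w.2 = 0 := by rw [hF2, zero_add] at hF1; exact hF1
  apply hw0
  refine Prod.ext (funext ?_) hw2
  rintro ⟨j, x, b, hb, rfl⟩
  have hb' := hzero b hb j
  have hsnd : (if j = i ∧ A b then LinearMap.snd ℚ ((Σ j, lab j) → ℚ) ℚ else 0) w = 0 := by
    split_ifs
    · exact hw2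
    · rfl
  simp only [F, LinearMap.add_apply, LinearMap.comp_apply] at hb'
  rw [hsnd, add_zero] at hb'
  exact (ext_apply j b hb).symm.trans hb'

end LatinBitrade

/-! ### Barycentric coordinates and triangles cut out by three lines -/

namespace TriangleDissection

/-- The barycentric coordinates with respect to `bigTriangle`. -/
def bary (i : Fin 3) (p : ℝ × ℝ) : ℝ := ![p.2, p.1, 1 - p.1 - p.2] i

theorem sum_bary (p : ℝ × ℝ) : ∑ i, bary i p = 1 := by
  simp [Fin.sum_univ_three, bary]
  ring

theorem continuous_bary (i : Fin 3) : Continuous (bary i) := by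
  unfold bary
  fin_cases i <;> simp <;> fun_prop

theorem bary_combo (i : Fin 3) (p q : ℝ × ℝ) {x y : ℝ} (h : x + y = 1) :
    bary i (x • p + y • q) = x * bary i p + y * bary i q := by
  obtain rfl : y = 1 - x := by linarith
  fin_cases i <;> simp [bary]
  ring

theorem bary_ext {i j : Fin 3} (h : i ≠ j) {p q : ℝ × ℝ} (hi : bary i p = bary i q)
    (hj : bary j p = bary j q) : p = q := by
  obtain ⟨x, y⟩ := p
  obtain ⟨z, w⟩ := q
  fin_cases i <;> fin_cases j <;> simp [bary] at h hi hj ⊢ <;> constructor <;> linarith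

theorem exists_bary {i j : Fin 3} (h : i ≠ j) (x y : ℝ) :
    ∃ p, bary i p = x ∧ bary j p = y := by
  have key : ∀ z : Fin 3 → ℝ, ∑ l, z l = 1 → ∃ p, ∀ l, bary l p = z l := by
    intro z hz
    rw [Fin.sum_univ_three] at hz
    refine ⟨(z 1, z 0), fun l => ?_⟩
    fin_cases l <;> simp [bary]
    linarith
  obtain ⟨k, hki, hkj, -⟩ := Fin.exists_third h
  obtain ⟨p, hp⟩ := key (fun l => if l = i then x else if l = j then y else 1 - x - y) (by
    rw [Fin.sum_univ_three_of_ne _ h hki hkj]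
    simp [h.symm, hki, hkj])
  exact ⟨p, by simp [hp], by simp [hp, h.symm]⟩

theorem dense_bary_ne (i : Fin 3) (x : ℝ) : Dense {p | bary i p ≠ x} := by
  have h2 : IsOpenMap fun p : ℝ × ℝ => p.1 + p.2 :=
    (ContinuousLinearMap.fst ℝ ℝ ℝ + ContinuousLinearMap.snd ℝ ℝ ℝ).isOpenMap
      fun y => ⟨(y, 0), by simp⟩
  fin_cases i
  · exact (dense_compl_singleton x).preimage isOpenMap_snd
  · exact (dense_compl_singleton x).preimage isOpenMap_fst
  · convert (dense_compl_singleton (1 - x)).preimage h2 using 1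
    ext p
    simp only [bary, Set.mem_ofPred_eq, Set.mem_preimage, Set.mem_compl_iff, Set.mem_singleton_iff]
    refine not_congr ⟨fun h => ?_, fun h => ?_⟩
    · simp at h
      linarith
    · simp
      linarith

/-- The signed size of the triangle cut out by the lines `bary i p = τ i`. -/
def excess (τ : Fin 3 → ℝ) : ℝ := 1 - ∑ i, τ i

/-- The common point of the lines `bary i p = τ i` with `i ≠ k`. -/
noncomputable def corner (τ : Fin 3 → ℝ) (k : Fin 3) : ℝ × ℝ :=
  (τ 1 + if 1 = k then excess τ else 0, τ 0 + if 0 = k then excess τ else 0)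

/-- The triangle cut out by the lines `bary i p = τ i`, if they are not concurrent. -/
def cell (τ : Fin 3 → ℝ) : Set (ℝ × ℝ) := {p | ∀ i, 0 ≤ excess τ * (bary i p - τ i)}

theorem bary_corner (τ : Fin 3 → ℝ) (i k : Fin 3) :
    bary i (corner τ k) = τ i + if i = k then excess τ else 0 := by
  fin_cases i <;> fin_cases k <;> simp [bary, corner, excess, Fin.sum_univ_three] <;> ring

theorem bary_corner_of_ne (τ : Fin 3 → ℝ) {i k : Fin 3} (h : i ≠ k) :
    bary i (corner τ k) = τ i := by
  simp [bary_corner, h]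

theorem bary_corner_self (τ : Fin 3 → ℝ) (i : Fin 3) :
    bary i (corner τ i) = τ i + excess τ := by
  simp [bary_corner]

theorem convex_cell (τ : Fin 3 → ℝ) : Convex ℝ (cell τ) := by
  intro p hp q hq x y hx hy hxy i
  rw [bary_combo i p q hxy]
  have h1 := mul_nonneg hx (hp i)
  have h2 := mul_nonneg hy (hq i)
  have : excess τ * (x * bary i p + y * bary i q - τ i) =
      x * (excess τ * (bary i p - τ i)) + y * (excess τ * (bary i q - τ i)) := by
    linear_combination (excess τ * τ i) * hxy
  rw [this]
  exact add_nonneg h1 h2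

theorem isClosed_cell (τ : Fin 3 → ℝ) : IsClosed (cell τ) := by
  simp only [cell, Set.ofPred_forall]
  exact isClosed_iInter fun i => isClosed_le continuous_const
    (continuous_const.mul ((continuous_bary i).sub continuous_const))

theorem corner_mem_cell (τ : Fin 3 → ℝ) (k : Fin 3) : corner τ k ∈ cell τ := by
  intro i
  rw [bary_corner]
  split_ifs
  · simpa using mul_self_nonneg (excess τ)
  · simp

/-- The weights `(bary i p - τ i) / excess τ` are nonnegative on the cell for either sign of the
excess, and they sum to 1 by the definition of the excess. -/
theorem convexHull_range_corner {τ : Fin 3 → ℝ} (hτ : excess τ ≠ 0) :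
    convexHull ℝ (Set.range (corner τ)) = cell τ := by
  apply Set.Subset.antisymm
  · exact convexHull_min (Set.range_subset_iff.2 (corner_mem_cell τ)) (convex_cell τ)
  · intro p hp
    have hw : ∀ i, 0 ≤ (bary i p - τ i) / excess τ := by
      intro i
      have := div_nonneg (hp i) (sq_nonneg (excess τ))
      rwa [pow_two, mul_div_mul_left _ _ hτ] at this
    have hsum : ∑ i, (bary i p - τ i) / excess τ = 1 := by
      rw [← Finset.sum_div, Finset.sum_sub_distrib, sum_bary, ← excess, div_self hτ]
    have heq : p = ∑ i, ((bary i p - τ i) / excess τ) • corner τ i := by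
      have h3 := hsum
      rw [Fin.sum_univ_three] at h3
      have e : ∀ x y : ℝ, (x - y) / excess τ * excess τ = x - y := fun x y => div_mul_cancel₀ _ hτ
      have e0 := e p.2 (τ 0)
      have e1 := e p.1 (τ 1)
      rw [Fin.sum_univ_three]
      apply Prod.ext
      · simp [corner, bary] at h3 ⊢
        linear_combination (- τ 1) * h3 - e1
      · simp [corner, bary] at h3 ⊢
        linear_combination (- τ 0) * h3 - e0
    rw [heq]
    exact (convex_convexHull ℝ _).sum_mem (fun i _ => hw i) hsum
      fun i _ => subset_convexHull ℝ _ (Set.mem_range_self i)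

theorem triangleOfLines_eq_cell {r c s : ℝ} (h : excess ![r, c, 1 - s] ≠ 0) :
    triangleOfLines (rowLine r) (columnLine c) (symbolLine s) = cell ![r, c, 1 - s] := by
  rw [← convexHull_range_corner h, triangleOfLines]
  congr 1
  ext ⟨x, y⟩
  simp only [rowLine, columnLine, symbolLine, Set.mem_union, Set.mem_inter_iff, Set.mem_ofPred_eq,
    Set.mem_range, Fin.exists_fin_succ, corner, excess, Fin.sum_univ_three, Prod.mk.injEq]
  simp
  constructor
  · rintro ((⟨rfl, rfl⟩ | ⟨rfl, h⟩) | ⟨rfl, h⟩)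
    · simp
    · right; left; constructor <;> linarith
    · left; constructor <;> linarith
  · rintro (⟨h1, h2⟩ | ⟨h1, h2⟩ | ⟨h1, h2⟩)
    · right; constructor <;> linarith
    · left; right; constructor <;> linarith
    · left; left; constructor <;> linarith

theorem excess_zero : excess 0 = 1 := by simp [excess]

theorem bigTriangle_eq_cell : bigTriangle = cell 0 := by
  ext p
  simp [bigTriangle, cell, excess_zero, Fin.forall_fin_succ, bary]
  constructor
  · rintro ⟨h1, h2, h3⟩
    exact ⟨h2, h1, by linarith⟩
  · rintro ⟨h1, h2, h3⟩
    exact ⟨h2, h1, by linarith⟩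

theorem cell_eq_image {τ : Fin 3 → ℝ} (hτ : excess τ ≠ 0) :
    cell τ = (fun p => excess τ • p + (τ 1, τ 0)) '' bigTriangle := by
  have hb : ∀ i q, bary i (excess τ • q + (τ 1, τ 0)) = excess τ * bary i q + τ i := by
    intro i q
    fin_cases i <;> simp [bary, excess, Fin.sum_univ_three] <;> ring
  have hpos : 0 < excess τ * excess τ := mul_self_pos.2 hτ
  have hmem : ∀ q, excess τ • q + (τ 1, τ 0) ∈ cell τ ↔ q ∈ bigTriangle := by
    intro q
    rw [bigTriangle_eq_cell]
    refine forall_congr' fun i => ?_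
    rw [hb, add_sub_cancel_right, ← mul_assoc, mul_nonneg_iff_of_pos_left hpos, excess_zero]
    simp
  ext p
  constructor
  · intro hp
    have : excess τ • ((excess τ)⁻¹ • (p - (τ 1, τ 0))) + (τ 1, τ 0) = p := by
      rw [smul_inv_smul₀ hτ, sub_add_cancel]
    exact ⟨_, (hmem _).1 (by rwa [this]), this⟩
  · rintro ⟨q, hq, rfl⟩
    exact (hmem q).2 hq

theorem corner_injective {τ : Fin 3 → ℝ} (hτ : excess τ ≠ 0) : Function.Injective (corner τ) := by
  intro j k h
  by_contra hjk
  have := congrArg (bary j) h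
  rw [bary_corner_self, bary_corner_of_ne _ hjk] at this
  exact hτ (by linarith)

theorem extremePoints_cell {τ : Fin 3 → ℝ} (hτ : excess τ ≠ 0) :
    (cell τ).extremePoints ℝ = Set.range (corner τ) := by
  apply Set.Subset.antisymm
  · rw [← convexHull_range_corner hτ]
    exact extremePoints_convexHull_subset
  · rintro _ ⟨k, rfl⟩
    rw [mem_extremePoints_iff_left]
    refine ⟨corner_mem_cell τ k, ?_⟩
    rintro p hp q hq ⟨x, y, hx, hy, hxy, hpq⟩
    have key : ∀ i, i ≠ k → bary i p = bary i (corner τ k) := by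
      intro i hi
      have h1 := congrArg (bary i) hpq
      rw [bary_combo i p q hxy, bary_corner_of_ne _ hi] at h1
      rw [bary_corner_of_ne _ hi]
      -- Each coordinate `i ≠ k` attains its bound at corner `k`, so two nonnegative terms with
      -- positive weights sum to zero.
      have h2 : x * (excess τ * (bary i p - τ i)) + y * (excess τ * (bary i q - τ i)) = 0 := by
        linear_combination (excess τ) * h1 - (excess τ * τ i) * hxy
      have h3 := (add_eq_zero_iff_of_nonneg (mul_nonneg hx.le (hp i))
        (mul_nonneg hy.le (hq i))).1 h2
      have h4 := (mul_eq_zero.1 ((mul_eq_zero.1 h3.1).resolve_left hx.ne')).resolve_left hτ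
      linarith
    have h : ∀ k : Fin 3, k + 1 ≠ k ∧ k + 2 ≠ k ∧ k + 1 ≠ k + 2 := by decide
    exact bary_ext (h k).2.2 (key _ (h k).1) (key _ (h k).2.1)

theorem mem_sides_cell {τ : Fin 3 → ℝ} (hτ : excess τ ≠ 0) (s : Set (ℝ × ℝ)) :
    s ∈ sides (cell τ) ↔ ∃ j k, j ≠ k ∧ s = segment ℝ (corner τ j) (corner τ k) := by
  simp only [sides, extremePoints_cell hτ, Set.mem_ofPred_eq]
  constructor
  · rintro ⟨_, ⟨j, rfl⟩, _, ⟨k, rfl⟩, hjk, rfl⟩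
    exact ⟨j, k, fun h => hjk (by rw [h]), rfl⟩
  · rintro ⟨j, k, hjk, rfl⟩
    exact ⟨_, ⟨j, rfl⟩, _, ⟨k, rfl⟩, (corner_injective hτ).ne hjk, rfl⟩

/-- The affine parametrization of the line `bary i p = x` by `bary j`. -/
theorem exists_lineMap {i j : Fin 3} (h : i ≠ j) (x : ℝ) :
    ∃ γ : ℝ →ᵃ[ℝ] ℝ × ℝ, ∀ y, bary i (γ y) = x ∧ bary j (γ y) = y := by
  obtain ⟨p, hp1, hp2⟩ := exists_bary h x 0
  obtain ⟨q, hq1, hq2⟩ := exists_bary h x 1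
  refine ⟨AffineMap.lineMap p q, fun y => ?_⟩
  rw [AffineMap.lineMap_apply_module, bary_combo i p q (by ring), bary_combo j p q (by ring), hp1,
    hq1, hp2, hq2]
  constructor <;> ring

theorem affineSpan_segment_eq {i : Fin 3} {x : ℝ} {p q p' q' : ℝ × ℝ} (hp : bary i p = x)
    (hq : bary i q = x) (hpq : p ≠ q) (hp' : bary i p' = x) (hq' : bary i q' = x) (hpq' : p' ≠ q') :
    affineSpan ℝ (segment ℝ p q) = affineSpan ℝ (segment ℝ p' q') := by
  rw [← convexHull_pair, ← convexHull_pair, affineSpan_convexHull, affineSpan_convexHull]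
  have key : ∀ u, bary i u = x → u ∈ line[ℝ, p', q'] := by
    intro u hu
    have hj : i ≠ i + 1 := (by decide : ∀ i : Fin 3, i ≠ i + 1) i
    have hne : bary (i + 1) q' - bary (i + 1) p' ≠ 0 := by
      intro h
      exact hpq' (bary_ext hj (hp'.trans hq'.symm) (by linarith))
    rw [mem_affineSpan_pair_iff_exists_lineMap_eq]
    refine ⟨(bary (i + 1) u - bary (i + 1) p') / (bary (i + 1) q' - bary (i + 1) p'), ?_⟩
    rw [AffineMap.lineMap_apply_module]
    apply bary_ext hj
    · rw [bary_combo _ _ _ (by ring), hp', hq', hu]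
      ring
    · rw [bary_combo _ _ _ (by ring)]
      field_simp
      ring
  exact affineSpan_pair_eq_of_mem_of_mem_of_ne (key p hp) (key q hq) hpq

theorem bary_eq_of_mem_affineSpan_segment {i : Fin 3} {x : ℝ} {p q u : ℝ × ℝ} (hp : bary i p = x)
    (hq : bary i q = x) (hu : u ∈ affineSpan ℝ (segment ℝ p q)) : bary i u = x := by
  rw [← convexHull_pair, affineSpan_convexHull, mem_affineSpan_pair_iff_exists_lineMap_eq] at hu
  obtain ⟨r, rfl⟩ := hu
  rw [AffineMap.lineMap_apply_module, bary_combo _ _ _ (by ring), hp, hq]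
  ring

/-- A convex set with nonempty interior lies in the closure of that interior, where a dense set
stays dense. This carries facts about generic points over to closed cells. -/
theorem cell_subset_closure {τ : Fin 3 → ℝ} (hτ : excess τ ≠ 0) {G : Set (ℝ × ℝ)} (hG : Dense G) :
    cell τ ⊆ closure (cell τ ∩ G) := by
  have hne : (interior (cell τ)).Nonempty := by
    have hpos : 0 < excess τ * excess τ := mul_self_pos.2 hτ
    let U : Set (ℝ × ℝ) := {p | ∀ i, 0 < excess τ * (bary i p - τ i)}
    have hU : IsOpen U := by
      simp only [U, Set.ofPred_forall]
      exact isOpen_iInter_of_finite fun i => isOpen_lt continuous_const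
        (continuous_const.mul ((continuous_bary i).sub continuous_const))
    have hUc : U ⊆ cell τ := fun p hp i => (hp i).le
    -- The centroid of the cell.
    refine ⟨(τ 1 + excess τ / 3, τ 0 + excess τ / 3), interior_maximal hUc hU ?_⟩
    have : ∀ i, bary i (τ 1 + excess τ / 3, τ 0 + excess τ / 3) = τ i + excess τ / 3 := by
      intro i
      fin_cases i <;> simp [bary, excess, Fin.sum_univ_three]
      ring
    intro i
    rw [this]
    linarith
  calc cell τ ⊆ closure (cell τ) := subset_closure
    _ = closure (interior (cell τ)) :=
      ((convex_cell τ).closure_interior_eq_closure_of_nonempty_interior hne).symm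
    _ ⊆ closure (closure (interior (cell τ) ∩ G)) :=
      closure_mono (hG.open_subset_closure_inter isOpen_interior)
    _ = closure (interior (cell τ) ∩ G) := closure_closure
    _ ⊆ closure (cell τ ∩ G) :=
      closure_mono (Set.inter_subset_inter_left _ interior_subset)

end TriangleDissection

open TriangleDissection

/-! ### Levelled bitrades and generic points -/

namespace LatinBitrade

variable {X : Type*}

/-- The levels of the lines assigned to the labels, in barycentric coordinates: the lines of `a` are
the sides of the big triangle, the lines of any other triple of the first mate are concurrent, and
different labels get different lines. -/
structure IsLevelled (T : LatinBitrade X) (a : Fin 3 → X) (t : Fin 3 → X → ℝ) : Prop where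
  mem : a ∈ T.star
  base : ∀ i, t i (a i) = 0
  concurrent : ∀ b ∈ T.star, b ≠ a → ∑ i, t i (b i) = 1
  separated : ∀ b ∈ T.star, ∀ d ∈ T.star, ∀ i, t i (b i) = t i (d i) → b i = d i

/-- The levels of the three lines of a triple. -/
def lev (t : Fin 3 → X → ℝ) (c : Fin 3 → X) : Fin 3 → ℝ := fun i => t i (c i)

theorem excess_lev {t : Fin 3 → X → ℝ} (c : Fin 3 → X) {i j k : Fin 3}
    (hij : i ≠ j) (hki : k ≠ i) (hkj : k ≠ j) :
    excess (lev t c) = 1 - (t i (c i) + t j (c j) + t k (c k)) := by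
  rw [excess, Fin.sum_univ_three_of_ne _ hij hki hkj]
  rfl

variable {T : LatinBitrade X} {a : Fin 3 → X} {t : Fin 3 → X → ℝ}

namespace IsLevelled

theorem excess_star (h : T.IsLevelled a t) {b : Fin 3 → X} (hb : b ∈ T.star) (hba : b ≠ a) :
    excess (lev t b) = 0 :=
  sub_eq_zero.2 (h.concurrent b hb hba).symm

theorem eq_of_star_tri (h : T.IsLevelled a t) {b c : Fin 3 → X} (hb : b ∈ T.star) (hc : c ∈ T.tri)
    {i : Fin 3} (hi : t i (b i) = t i (c i)) : b i = c i := by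
  obtain ⟨d, hd, h1, -⟩ := T.exists_star hc ((by decide : ∀ i : Fin 3, i ≠ i + 1) i)
  rw [← h1] at hi ⊢
  exact h.separated b hb d hd i hi

theorem eq_of_tri (h : T.IsLevelled a t) {c d : Fin 3 → X} (hc : c ∈ T.tri) (hd : d ∈ T.tri)
    {i : Fin 3} (hi : t i (c i) = t i (d i)) : c i = d i := by
  obtain ⟨b, hb, h1, -⟩ := T.exists_star hc ((by decide : ∀ i : Fin 3, i ≠ i + 1) i)
  rw [← h1] at hi ⊢
  exact h.eq_of_star_tri hb hd hi

/-- If the lines of `c` were concurrent, a triple `b ≠ a` of `star` sharing two labels with `c`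
would share the third line, hence by separation the third label. Disjointness forbids this, so all
such neighbours equal `a`, giving `c = a`, again impossible. -/
theorem excess_ne_zero (h : T.IsLevelled a t) {c : Fin 3 → X} (hc : c ∈ T.tri) :
    excess (lev t c) ≠ 0 := by
  intro h0
  have key : ∀ i j : Fin 3, i ≠ j → a i = c i ∧ a j = c j := by
    intro i j hij
    obtain ⟨b, hb, h1, h2⟩ := T.exists_star hc hij
    obtain ⟨k, hki, hkj, hk⟩ := Fin.exists_third hij
    by_cases hba : b = a
    · exact hba ▸ ⟨h1, h2⟩
    · have e := h.excess_star hb hba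
      rw [excess_lev _ hij hki hkj] at e h0
      have h3 : b k = c k := h.eq_of_star_tri hb hc (by rw [h1, h2] at e; linarith)
      have : b = c := by
        funext l
        rcases hk l with rfl | rfl | rfl <;> assumption
      exact absurd hc (this ▸ Finset.disjoint_left.1 T.disj hb)
  have hac : a = c := by
    funext l
    exact (key l (l + 1) ((by decide : ∀ i : Fin 3, i ≠ i + 1) l)).1
  exact Finset.disjoint_left.1 T.disj h.mem (hac ▸ hc)

end IsLevelled

open Classical in
/-- For a point off the lines of `cell τ`, membership in the cell as a polynomial of degree two in
the sides of the lines on which the point lies. -/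
theorem indicator_cell {τ : Fin 3 → ℝ} {p : ℝ × ℝ} (hp : ∀ i, bary i p ≠ τ i) (s : Fin 3 → ℤ)
    (hs : ∀ i, s i = if τ i < bary i p then 1 else 0) :
    1 - s 0 - s 1 - s 2 + s 0 * s 1 + s 0 * s 2 + s 1 * s 2 =
      if excess τ ≠ 0 ∧ p ∈ cell τ then 1 else 0 := by
  have hsum : excess τ = ∑ i, (bary i p - τ i) := by
    rw [Finset.sum_sub_distrib, sum_bary, excess]
  rw [Fin.sum_univ_three] at hsum
  -- The excess is the sum of the three differences, so the point is inside exactly when all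
  -- differences have one sign. The polynomial is 1 exactly when the three indicators coincide.
  have hmem : (excess τ ≠ 0 ∧ p ∈ cell τ) ↔
      (∀ i, τ i < bary i p) ∨ ∀ i, bary i p < τ i := by
    constructor
    · rintro ⟨h0, hc⟩
      rcases lt_or_gt_of_ne h0 with h | h
      · right
        exact fun i => lt_of_le_of_ne (by have := nonpos_of_mul_nonneg_right (hc i) h; linarith) (hp i)
      · left
        exact fun i => lt_of_le_of_ne
          (by have := nonneg_of_mul_nonneg_right (hc i) h; linarith) (hp i).symm
    · rintro (h | h)
      · have : 0 < excess τ := by linarith [h 0, h 1, h 2]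
        exact ⟨this.ne', fun i => mul_nonneg this.le (sub_nonneg.2 (h i).le)⟩
      · have : excess τ < 0 := by linarith [h 0, h 1, h 2]
        exact ⟨this.ne, fun i => mul_nonneg_of_nonpos_of_nonpos this.le (sub_nonpos.2 (h i).le)⟩
  have hlt : ∀ i, bary i p < τ i ↔ ¬ τ i < bary i p := fun i =>
    ⟨fun h => h.not_gt, fun h => lt_of_le_of_ne (not_lt.1 h) (hp i)⟩
  simp only [hmem, hlt, hs, Fin.forall_fin_succ, Fin.forall_fin_zero]
  by_cases h0 : τ 0 < bary 0 p <;> by_cases h1 : τ 1 < bary 1 p <;>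
    by_cases h2 : τ 2 < bary 2 p <;> simp [h0, h1, h2]

/-- The points that lie on no line of the bitrade. -/
def generic (T : LatinBitrade X) (t : Fin 3 → X → ℝ) : Set (ℝ × ℝ) :=
  {p | ∀ c ∈ T.tri, ∀ i, bary i p ≠ t i (c i)}

theorem dense_generic (T : LatinBitrade X) (t : Fin 3 → X → ℝ) : Dense (T.generic t) := by
  have : T.generic t = ⋂ q ∈ (T.tri : Set (Fin 3 → X)) ×ˢ (Set.univ : Set (Fin 3)),
      {p | bary q.2 p ≠ t q.2 (q.1 q.2)} := by
    ext p
    simp only [generic, Set.mem_ofPred_eq, Set.mem_iInter, Set.mem_prod, Set.mem_univ, and_true,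
      Prod.forall, Finset.mem_coe]
    exact ⟨fun h c i hc => h c hc i, fun h c hc i => h c i hc⟩
  rw [this]
  refine dense_biInter_of_isOpen ?_ ?_ ?_
  · exact fun q _ => isOpen_ne_fun (continuous_bary _) continuous_const
  · exact (T.tri.finite_toSet.prod Set.finite_univ).countable
  · exact fun q _ => dense_bary_ne _ _

/-! ### The cells tile the big triangle -/

namespace IsLevelled

open Classical in
theorem card_filter_mem_cell (h : T.IsLevelled a t) {p : ℝ × ℝ} (hp : p ∈ T.generic t) :
    (T.tri.filter fun c => p ∈ cell (lev t c)).card = if p ∈ bigTriangle then 1 else 0 := by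
  have hstar : ∀ b ∈ T.star, ∀ i, bary i p ≠ lev t b i := by
    intro b hb i
    obtain ⟨c, hc, h1, -⟩ := T.exists_tri hb ((by decide : ∀ i : Fin 3, i ≠ i + 1) i)
    rw [lev, h1]
    exact hp c hc i
  let s : Fin 3 → (Fin 3 → X) → ℤ := fun i c => if t i (c i) < bary i p then 1 else 0
  have hs : T.Compatible s := fun i j _ b _ c _ h1 _ => by simp only [s, h1]
  have hsum : ∑ b ∈ T.star, (if excess (lev t b) ≠ 0 ∧ p ∈ cell (lev t b) then (1 : ℤ) else 0) =
      ∑ c ∈ T.tri, (if excess (lev t c) ≠ 0 ∧ p ∈ cell (lev t c) then (1 : ℤ) else 0) := by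
    rw [← Finset.sum_congr rfl fun b hb => indicator_cell (hstar b hb) (fun i => s i b) fun i => rfl,
      ← Finset.sum_congr rfl fun c hc => indicator_cell (τ := lev t c) (hp c hc) (fun i => s i c) fun i => rfl]
    simp only [Finset.sum_add_distrib, Finset.sum_sub_distrib]
    rw [hs.sum_star_single (fun x => x) 0, hs.sum_star_single (fun x => x) 1,
      hs.sum_star_single (fun x => x) 2, hs.sum_star_mul (i := 0) (j := 1) (by decide),
      hs.sum_star_mul (i := 0) (j := 2) (by decide), hs.sum_star_mul (i := 1) (j := 2) (by decide)]
    simp [card_star_eq_card_tri]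
  -- Concurrent lines have excess 0, so over `star` only the big triangle, cut out by `a`, remains.
  rw [Finset.sum_eq_single_of_mem a h.mem fun b hb hba => by simp [h.excess_star hb hba]] at hsum
  have ha : lev t a = 0 := funext h.base
  have htri : ∑ c ∈ T.tri, (if excess (lev t c) ≠ 0 ∧ p ∈ cell (lev t c) then (1 : ℤ) else 0) =
      ∑ c ∈ T.tri, if p ∈ cell (lev t c) then 1 else 0 :=
    Finset.sum_congr rfl fun c hc => by simp [h.excess_ne_zero hc]
  rw [htri, Finset.sum_boole, ha, ← bigTriangle_eq_cell, excess_zero] at hsum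
  simp only [ne_eq, one_ne_zero, not_false_eq_true, true_and] at hsum
  split_ifs at hsum ⊢ <;> exact_mod_cast hsum.symm

theorem mem_bigTriangle (h : T.IsLevelled a t) {p : ℝ × ℝ} (hp : p ∈ T.generic t) {c : Fin 3 → X}
    (hc : c ∈ T.tri) (hpc : p ∈ cell (lev t c)) : p ∈ bigTriangle := by
  classical
  by_contra hn
  have := h.card_filter_mem_cell hp
  rw [if_neg hn, Finset.card_eq_zero] at this
  exact Finset.eq_empty_iff_forall_notMem.1 this c (Finset.mem_filter.2 ⟨hc, hpc⟩)

theorem eq_of_mem_cell (h : T.IsLevelled a t) {p : ℝ × ℝ} (hp : p ∈ T.generic t)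
    {c d : Fin 3 → X} (hc : c ∈ T.tri) (hd : d ∈ T.tri) (hpc : p ∈ cell (lev t c))
    (hpd : p ∈ cell (lev t d)) : c = d := by
  classical
  have := h.card_filter_mem_cell hp
  rw [if_pos (h.mem_bigTriangle hp hc hpc)] at this
  exact Finset.card_le_one.1 this.le c (Finset.mem_filter.2 ⟨hc, hpc⟩) d
    (Finset.mem_filter.2 ⟨hd, hpd⟩)

theorem cell_subset_bigTriangle (h : T.IsLevelled a t) {c : Fin 3 → X} (hc : c ∈ T.tri) :
    cell (lev t c) ⊆ bigTriangle := by
  refine (cell_subset_closure (h.excess_ne_zero hc) (T.dense_generic t)).trans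
    (closure_minimal ?_ (bigTriangle_eq_cell ▸ isClosed_cell 0))
  exact fun p hp => h.mem_bigTriangle hp.2 hc hp.1

theorem iUnion_cell (h : T.IsLevelled a t) : ⋃ c ∈ T.tri, cell (lev t c) = bigTriangle := by
  classical
  apply Set.Subset.antisymm
  · exact Set.iUnion₂_subset fun c hc => h.cell_subset_bigTriangle hc
  · have hcl : IsClosed (⋃ c ∈ T.tri, cell (lev t c)) :=
      T.tri.finite_toSet.isClosed_biUnion fun c _ => isClosed_cell _
    have hsub := cell_subset_closure (by rw [excess_zero]; exact one_ne_zero) (T.dense_generic t)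
    rw [← bigTriangle_eq_cell] at hsub
    refine hsub.trans (closure_minimal ?_ hcl)
    rintro p ⟨hp, hpg⟩
    have := h.card_filter_mem_cell hpg
    rw [if_pos hp] at this
    obtain ⟨c, hc⟩ := Finset.card_pos.1 (this ▸ Nat.one_pos)
    rw [Finset.mem_filter] at hc
    exact Set.mem_iUnion₂.2 ⟨c, hc.1, hc.2⟩

theorem injOn_cell (h : T.IsLevelled a t) :
    Set.InjOn (fun c => cell (lev t c)) (T.tri : Set (Fin 3 → X)) := by
  intro c hc d hd hcd
  dsimp only at hcd
  have hne : (closure (cell (lev t c) ∩ T.generic t)).Nonempty :=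
    ⟨_, cell_subset_closure (h.excess_ne_zero hc) (T.dense_generic t) (corner_mem_cell _ 0)⟩
  obtain ⟨p, hp, hpg⟩ := closure_nonempty_iff.1 hne
  exact h.eq_of_mem_cell hpg hc hd hp (hcd ▸ hp)

theorem disjoint_interior_cell (h : T.IsLevelled a t) {c d : Fin 3 → X} (hc : c ∈ T.tri)
    (hd : d ∈ T.tri) (hcd : c ≠ d) :
    Disjoint (interior (cell (lev t c))) (interior (cell (lev t d))) := by
  rw [Set.disjoint_iff_inter_eq_empty]
  by_contra hne
  obtain ⟨p, hp, hpg⟩ := (T.dense_generic t).inter_open_nonempty _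
    (isOpen_interior.inter isOpen_interior) (Set.nonempty_iff_ne_empty.2 hne)
  exact hcd (h.eq_of_mem_cell hpg hc hd (interior_subset hp.1) (interior_subset hp.2))

theorem isDissection (h : T.IsLevelled a t) :
    IsDissection bigTriangle ((fun c => cell (lev t c)) '' (T.tri : Set (Fin 3 → X))) where
  finite := T.tri.finite_toSet.image _
  nontrivial := by
    -- If the neighbours of `a` along two different pairs of coordinates were equal, they would
    -- equal `a`.
    obtain ⟨c, hc, h1, h2⟩ := T.exists_tri h.mem (i := 0) (j := 1) (by decide)
    obtain ⟨d, hd, h3, h4⟩ := T.exists_tri h.mem (i := 0) (j := 2) (by decide)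
    refine ⟨_, ⟨c, hc, rfl⟩, _, ⟨d, hd, rfl⟩, h.injOn_cell.ne hc hd ?_⟩
    rintro rfl
    have : a = c := by
      funext l
      fin_cases l <;> assumption
    exact Finset.disjoint_left.1 T.disj h.mem (this ▸ hc)
  homothetic := by
    rintro _ ⟨c, hc, rfl⟩
    exact ⟨_, _, h.excess_ne_zero hc, cell_eq_image (h.excess_ne_zero hc)⟩
  disjoint_interior := by
    rintro _ ⟨c, hc, rfl⟩ _ ⟨d, hd, rfl⟩ hcd
    exact h.disjoint_interior_cell hc hd fun e => hcd (by rw [e])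
  union := by
    rw [Set.sUnion_image]
    exact h.iUnion_cell

/-! ### Separation: vertices and contiguity of sides -/

/-- Being corner `k` of a cell fixes the levels of the two lines through the point, hence two
labels, hence the triple: at most one cell for each `k`. -/
theorem ncard_corner_le (h : T.IsLevelled a t) (P : ℝ × ℝ) :
    {Δ | Δ ∈ (fun c => cell (lev t c)) '' (T.tri : Set (Fin 3 → X)) ∧
      P ∈ Δ.extremePoints ℝ}.ncard ≤ 3 := by
  classical
  let F (k : Fin 3) : Finset (Fin 3 → X) := T.tri.filter fun c => corner (lev t c) k = P
  have hF : ∀ k ∈ Finset.univ, (F k).card ≤ 1 := by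
    intro k _
    rw [Finset.card_le_one]
    intro c hc d hd
    rw [Finset.mem_filter] at hc hd
    have key : ∀ i, i ≠ k → c i = d i := by
      intro i hi
      apply h.eq_of_tri hc.1 hd.1
      have := congrArg (bary i) (hc.2.trans hd.2.symm)
      rwa [bary_corner_of_ne _ hi, bary_corner_of_ne _ hi] at this
    have hk : ∀ k : Fin 3, k + 1 ≠ k ∧ k + 2 ≠ k ∧ k + 1 ≠ k + 2 := by decide
    exact T.tri_unique hc.1 hd.1 (hk k).2.2 (key _ (hk k).1) (key _ (hk k).2.1)
  have hsub : {Δ | Δ ∈ (fun c => cell (lev t c)) '' (T.tri : Set (Fin 3 → X)) ∧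
      P ∈ Δ.extremePoints ℝ} ⊆
      ((Finset.univ.biUnion F).image fun c => cell (lev t c) : Finset (Set (ℝ × ℝ))) := by
    rintro _ ⟨⟨c, hc, rfl⟩, hP⟩
    dsimp only at hP
    rw [extremePoints_cell (h.excess_ne_zero hc)] at hP
    obtain ⟨k, hk⟩ := hP
    rw [Finset.mem_coe, Finset.mem_image]
    exact ⟨c, Finset.mem_biUnion.2 ⟨k, Finset.mem_univ k, Finset.mem_filter.2 ⟨hc, hk⟩⟩, rfl⟩
  calc _ ≤ _ := Set.ncard_le_ncard hsub (Finset.finite_toSet _)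
    _ = _ := Set.ncard_coe_finset _
    _ ≤ _ := Finset.card_image_le
    _ ≤ _ := Finset.card_biUnion_le_card_mul _ _ _ hF
    _ = 3 := by simp

/-- The values of `bary j` on the sides that lie on the line of the label `r` at coordinate `i`. -/
def sideRange (T : LatinBitrade X) (t : Fin 3 → X → ℝ) (i j : Fin 3) (r : X) : Set ℝ :=
  {x | ∃ c ∈ T.tri, c i = r ∧ x ∈ Set.uIcc (t j (c j)) (t j (c j) + excess (lev t c))}

theorem isCompact_sideRange (i j : Fin 3) (r : X) : IsCompact (sideRange T t i j r) := by
  have : sideRange T t i j r = ⋃ c ∈ {c | c ∈ T.tri ∧ c i = r},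
      Set.uIcc (t j (c j)) (t j (c j) + excess (lev t c)) := by
    ext x
    simp [sideRange, and_assoc]
  rw [this]
  exact (T.tri.finite_toSet.subset fun c hc => hc.1).isCompact_biUnion fun c _ => isCompact_uIcc

/-- The signed count of the sides on a line that pass over a point. -/
theorem sum_side_eq (h : T.IsLevelled a t) {i j k : Fin 3} (hij : i ≠ j) (hki : k ≠ i) (hkj : k ≠ j)
    (y : ℝ) : ∑ c ∈ T.tri.filter (fun c => t i (c i) = 0),
      ((if t j (c j) < y then 1 else 0) - (if t j (c j) + excess (lev t c) < y then 1 else 0) : ℤ) =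
      (if 0 < y then 1 else 0) - (if 1 < y then 1 else 0) := by
  -- One end of a side depends on coordinates `i` and `j`, the other on `i` and `k`, so each
  -- indicator transfers between the mates. For `b ≠ a` in `star` the two ends coincide and cancel.
  have hex : ∀ c, t j (c j) + excess (lev t c) = 1 - (t i (c i) + t k (c k)) := fun c => by
    rw [excess_lev c hij hki hkj]
    ring
  have hstar : ∑ b ∈ T.star, (if t i (b i) = 0 then
      ((if t j (b j) < y then 1 else 0) - (if t j (b j) + excess (lev t b) < y then 1 else 0) : ℤ)
      else 0) = (if 0 < y then 1 else 0) - (if 1 < y then 1 else 0) := by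
    rw [Finset.sum_eq_single_of_mem a h.mem fun b hb hba => by simp [h.excess_star hb hba]]
    have : lev t a = 0 := funext h.base
    simp [h.base, this, excess_zero]
  rw [← hstar, Finset.sum_filter]
  simp only [hex]
  have split : ∀ (P : Prop) [Decidable P] (m n : ℤ),
      (if P then m - n else 0) = (if P then m else 0) - (if P then n else 0) := by
    intro P _ m n
    split_ifs <;> simp
  simp only [split, Finset.sum_sub_distrib]
  congr 1
  · exact (T.sum_star_eq_sum_tri hij _ fun b _ c _ h1 h2 => by rw [h1, h2]).symm
  · exact (T.sum_star_eq_sum_tri hki.symm _ fun b _ c _ h1 h2 => by rw [h1, h2]).symm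

/-- If no side on the line covers `y`, each lies entirely below or above it. Off the lines of `a`,
concurrency makes a triple of `star` join an end of one side to an end of another at the same point,
so being below `y` passes between the mates and contradicts `cycle_trivial`. On a line of `a` the
signed count would be 0, but it is 1 for `0 < y ≤ 1`. -/
theorem ordConnected_sideRange (hT : T.Spherical) (h : T.IsLevelled a t) {i j : Fin 3} (hij : i ≠ j)
    (r : X) : (sideRange T t i j r).OrdConnected := by
  refine ⟨fun x hx z hz y hy => ?_⟩
  by_contra hn
  obtain ⟨k, hki, hkj, hk⟩ := Fin.exists_third hij
  have hiff : ∀ c ∈ T.tri, c i = r →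
      (t j (c j) < y ↔ t j (c j) + excess (lev t c) < y) := by
    intro c hc hcr
    have hy' : y ∉ Set.uIcc (t j (c j)) (t j (c j) + excess (lev t c)) :=
      fun h' => hn ⟨c, hc, hcr, h'⟩
    rw [Set.mem_uIcc, not_or, not_and_or, not_and_or] at hy'
    constructor <;> intro h' <;> by_contra h'' <;> rcases hy' with ⟨h1 | h1, h2 | h2⟩ <;> linarith
  obtain ⟨c₁, hc₁, hr₁, hx₁⟩ := hx
  obtain ⟨c₂, hc₂, hr₂, hz₂⟩ := hz
  have hlt₁ : t j (c₁ j) < y := by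
    by_contra hcon
    have hcon' := (not_congr (hiff c₁ hc₁ hr₁)).1 hcon
    have hxy : x = y := by
      rcases Set.mem_uIcc.1 hx₁ with h' | h' <;> linarith [hy.1]
    exact hn ⟨c₁, hc₁, hr₁, hxy ▸ hx₁⟩
  have hlt₂ : ¬ t j (c₂ j) < y := by
    intro hcon
    have hcon' := (hiff c₂ hc₂ hr₂).1 hcon
    rcases Set.mem_uIcc.1 hz₂ with h' | h' <;> linarith [hy.2]
  by_cases hra : r = a i
  · have hsum := h.sum_side_eq hij hki hkj y
    rw [Finset.sum_eq_zero] at hsum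
    · have hb₁ := h.cell_subset_bigTriangle hc₁ (corner_mem_cell _ k)
      have hb₂ := h.cell_subset_bigTriangle hc₂ (corner_mem_cell _ k)
      rw [bigTriangle_eq_cell] at hb₁ hb₂
      have e : ∀ c l, corner (lev t c) k ∈ cell 0 → 0 ≤ bary l (corner (lev t c) k) := by
        intro c l hc
        simpa [excess_zero] using hc l
      have e₁ := e c₁ j hb₁
      have e₂ := sum_bary (corner (lev t c₂) k)
      rw [Fin.sum_univ_three_of_ne _ hij hki hkj] at e₂
      have e₃ := e c₂ i hb₂
      have e₄ := e c₂ k hb₂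
      have e₅ : bary j (corner (lev t c₁) k) = t j (c₁ j) := bary_corner_of_ne _ hkj.symm
      have e₆ : bary j (corner (lev t c₂) k) = t j (c₂ j) := bary_corner_of_ne _ hkj.symm
      rw [if_pos (by linarith), if_neg (by linarith)] at hsum
      norm_num at hsum
    · intro c hc
      rw [Finset.mem_filter, ← h.base i] at hc
      have hcr : c i = r := hra ▸ (h.eq_of_star_tri h.mem hc.1 hc.2.symm).symm
      simp [hiff c hc.1 hcr]
  · obtain ⟨b₁, hb₁, h1, h1'⟩ := T.exists_star hc₁ hij
    obtain ⟨b₂, hb₂, h2, h2'⟩ := T.exists_star hc₂ hij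
    refine hT.cycle_trivial h.mem i (fun b => b i = r ∧ t j (b j) < y) ?_ hb₁ hb₂
      (by rw [h1, h2, hr₁, hr₂]) ⟨h1.trans hr₁, h1'.symm ▸ hlt₁⟩ fun h' => hlt₂ (h2' ▸ h'.2)
    intro l hil b hb c hc hbi hbl
    rw [hbi]
    refine and_congr_right fun hcr => ?_
    rcases hk l with rfl | rfl | rfl
    · exact absurd rfl hil
    · rw [hbl]
    · have hba : b ≠ a := by
        rintro rfl
        exact hra (hcr.symm.trans hbi.symm)
      have e := h.excess_star hb hba
      -- With `i` and `k` shared, the far end of the side of `c` is `t j (b j)`, as the lines of `b`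
      -- are concurrent; by `hiff` either end decides the position relative to `y`.
      rw [hiff c hc hcr, excess_lev c hij hki hkj, ← hbi, ← hbl]
      rw [excess_lev b hij hki hkj] at e
      have : t j (c j) + (1 - (t i (b i) + t j (c j) + t l (b l))) = t j (b j) := by linarith
      rw [this]

/-- Parametrized by `bary j`, the union of sides is the affine image of `sideRange`, which is
nonempty, compact and order connected, hence a closed interval. -/
theorem sidesOn_eq_segment (hT : T.Spherical) (h : T.IsLevelled a t) {c : Fin 3 → X}
    (hc : c ∈ T.tri) {s : Set (ℝ × ℝ)} (hs : s ∈ sides (cell (lev t c))) :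
    ∃ p q : ℝ × ℝ, sidesOn ((fun c => cell (lev t c)) '' (T.tri : Set (Fin 3 → X)))
      (affineSpan ℝ s) = segment ℝ p q := by
  rw [mem_sides_cell (h.excess_ne_zero hc)] at hs
  obtain ⟨k, j, hkj, rfl⟩ := hs
  obtain ⟨i, hik, hij, hi⟩ := Fin.exists_third hkj
  obtain ⟨γ, hγ⟩ := exists_lineMap hij (t i (c i))
  have hside : ∀ d, t i (d i) = t i (c i) →
      segment ℝ (corner (lev t d) k) (corner (lev t d) j) =
        γ '' Set.uIcc (t j (d j)) (t j (d j) + excess (lev t d)) := by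
    intro d hd
    rw [← segment_eq_uIcc, image_segment]
    congr 1
    · refine bary_ext hij ?_ ?_
      · rw [bary_corner_of_ne _ hik, (hγ _).1]
        exact hd
      · rw [bary_corner_of_ne _ hkj.symm, (hγ _).2]
        rfl
    · refine bary_ext hij ?_ ?_
      · rw [bary_corner_of_ne _ hij, (hγ _).1]
        exact hd
      · rw [bary_corner_self, (hγ _).2]
        rfl
  have hmain : sidesOn ((fun c => cell (lev t c)) '' (T.tri : Set (Fin 3 → X)))
      (affineSpan ℝ (segment ℝ (corner (lev t c) k) (corner (lev t c) j))) =
      γ '' sideRange T t i j (c i) := by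
    ext p
    constructor
    · rintro ⟨s, ⟨_, ⟨d, hd, rfl⟩, hs, hspan⟩, hp⟩
      have h0 := h.excess_ne_zero hd
      rw [mem_sides_cell h0] at hs
      obtain ⟨k', j', hkj', rfl⟩ := hs
      have hline : ∀ u ∈ segment ℝ (corner (lev t d) k') (corner (lev t d) j'),
          bary i u = t i (c i) := by
        intro u hu
        have : u ∈ affineSpan ℝ (segment ℝ (corner (lev t d) k') (corner (lev t d) j')) :=
          subset_affineSpan ℝ _ hu
        rw [hspan] at this
        exact bary_eq_of_mem_affineSpan_segment (bary_corner_of_ne _ hik) (bary_corner_of_ne _ hij)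
          this
      have hk' := hline _ (left_mem_segment ℝ _ _)
      have hj' := hline _ (right_mem_segment ℝ _ _)
      -- A side ending at the corner opposite line `i` has ends whose `bary i` differ by the excess,
      -- so it cannot lie on a line of constant `bary i`.
      have hik' : i ≠ k' := by
        rintro rfl
        rw [bary_corner_self] at hk'
        rw [bary_corner_of_ne _ hkj'] at hj'
        exact h0 (by linarith)
      have hij' : i ≠ j' := by
        rintro rfl
        rw [bary_corner_self] at hj'
        rw [bary_corner_of_ne _ hik'] at hk'
        exact h0 (by linarith)
      have hdc : t i (d i) = t i (c i) := by
        rw [bary_corner_of_ne _ hik'] at hk'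
        exact hk'
      have hp' : p ∈ segment ℝ (corner (lev t d) k) (corner (lev t d) j) := by
        rcases hi k' with rfl | rfl | rfl
        · rcases hi j' with rfl | rfl | rfl
          · exact absurd rfl hkj'
          · exact hp
          · exact absurd rfl hij'
        · rcases hi j' with rfl | rfl | rfl
          · rwa [segment_symm]
          · exact absurd rfl hkj'
          · exact absurd rfl hij'
        · exact absurd rfl hik'
      rw [hside d hdc] at hp'
      obtain ⟨x, hx, rfl⟩ := hp'
      exact ⟨x, ⟨d, hd, h.eq_of_tri hd hc hdc, hx⟩, rfl⟩
    · rintro ⟨x, ⟨d, hd, hdc, hx⟩, rfl⟩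
      have hdc' : t i (d i) = t i (c i) := by rw [hdc]
      refine ⟨segment ℝ (corner (lev t d) k) (corner (lev t d) j), ⟨_, ⟨d, hd, rfl⟩, ?_, ?_⟩, ?_⟩
      · exact (mem_sides_cell (h.excess_ne_zero hd) _).2 ⟨k, j, hkj, rfl⟩
      · exact affineSpan_segment_eq (i := i) (x := t i (c i))
          ((bary_corner_of_ne _ hik).trans hdc') ((bary_corner_of_ne _ hij).trans hdc')
          ((corner_injective (h.excess_ne_zero hd)).ne hkj)
          (bary_corner_of_ne _ hik) (bary_corner_of_ne _ hij)
          ((corner_injective (h.excess_ne_zero hc)).ne hkj)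
      · rw [hside d hdc']
        exact ⟨x, hx, rfl⟩
  have hne : (sideRange T t i j (c i)).Nonempty := ⟨t j (c j), c, hc, rfl, Set.left_mem_uIcc⟩
  have hord := h.ordConnected_sideRange hT hij (c i)
  have hcpt := isCompact_sideRange (T := T) (t := t) i j (c i)
  have hIcc := eq_Icc_of_connected_compact ⟨hne, hord.isPreconnected⟩ hcpt
  have hle : sInf (sideRange T t i j (c i)) ≤ sSup (sideRange T t i j (c i)) := by
    rw [hIcc] at hne
    exact Set.nonempty_Icc.1 hne
  rw [← segment_eq_Icc hle] at hIcc
  exact ⟨_, _, by rw [hmain, hIcc, image_segment]⟩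

theorem isSeparated (hT : T.Spherical) (h : T.IsLevelled a t) :
    IsSeparated ((fun c => cell (lev t c)) '' (T.tri : Set (Fin 3 → X))) where
  valence P := by
    have := h.ncard_corner_le P
    omega
  contiguous := by
    rintro _ ⟨c, hc, rfl⟩ s hs
    exact h.sidesOn_eq_segment hT hc hs

end IsLevelled

/-- The barycentric levels that belong to a solution of `Eq(T,a)`. -/
def levels (v : Fin 3 → X → ℚ) (i : Fin 3) (x : X) : ℝ :=
  ![(v 0 x : ℝ), (v 1 x : ℝ), 1 - (v 2 x : ℝ)] i

theorem isLevelled_levels {v : Fin 3 → X → ℚ} (ha : a ∈ T.star) (hv : T.IsSolution a v)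
    (hsep : T.IsSeparatedSolution v) : T.IsLevelled a (levels v) where
  mem := ha
  base i := by
    fin_cases i <;> simp [levels, hv.1, hv.2.1, hv.2.2.1]
  concurrent b hb hba := by
    have : (v 0 (b 0) : ℝ) + v 1 (b 1) = v 2 (b 2) := by exact_mod_cast hv.2.2.2 b hb hba
    simp [Fin.sum_univ_three, levels, this]
  separated b hb d hd i hi := by
    apply (hsep b hb d hd i).1
    fin_cases i <;> simpa [levels] using hi

theorem cellTriangle_eq_cell {v : Fin 3 → X → ℚ} {c : Fin 3 → X}
    (hc : excess (lev (levels v) c) ≠ 0) : cellTriangle v c = cell (lev (levels v) c) := by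
  have : lev (levels v) c = ![(v 0 (c 0) : ℝ), (v 1 (c 1) : ℝ), 1 - (v 2 (c 2) : ℝ)] := by
    funext i
    fin_cases i <;> rfl
  rw [this] at hc ⊢
  exact triangleOfLines_eq_cell hc

theorem Indecomposable.solution_unique (hT : T.Indecomposable) (ha : a ∈ T.star)
    {v w : Fin 3 → X → ℚ} (hv : T.IsSolution a v) (hw : T.IsSolution a w) :
    ∀ b ∈ T.star, ∀ i, w i (b i) = v i (b i) := by
  -- The symbol difference is reversed so that `b 0 + b 1 = b 2` becomes a vanishing sum.
  let u : Fin 3 → X → ℚ := ![fun x => w 0 x - v 0 x, fun x => w 1 x - v 1 x, fun x => v 2 x - w 2 x]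
  have hua : ∀ i, u i (a i) = 0 := by
    obtain ⟨h0, h1, h2, -⟩ := hv
    obtain ⟨h3, h4, h5, -⟩ := hw
    intro i
    fin_cases i <;> simp [u, *]
  have key := hT.eq_zero (f := fun i b => u i (b i)) (fun i j _ b _ c _ h1 _ => by simp only [h1]) ha
    hua (by
      intro b hb
      by_cases hba : b = a
      · subst hba
        exact Finset.sum_eq_zero fun i _ => hua i
      · have h1 := hv.2.2.2 b hb hba
        have h2 := hw.2.2.2 b hb hba
        simp only [Fin.sum_univ_three, u]
        simp
        linarith)
  intro b hb i
  have h1 := key b hb i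
  fin_cases i <;> simp [u] at h1 ⊢ <;> linarith

end LatinBitrade

theorem theorem2p1 {X : Type*} (T : LatinBitrade X) (hT : T.Spherical)
    (a : Fin 3 → X) (ha : a ∈ T.star)
    (v : Fin 3 → X → ℚ) (hv : T.IsSolution a v) (hsep : T.IsSeparatedSolution v) :
    (∀ w : Fin 3 → X → ℚ, T.IsSolution a w →
      ∀ b ∈ T.star, ∀ i : Fin 3, w i (b i) = v i (b i)) ∧
    Set.InjOn (TriangleDissection.cellTriangle v) (T.tri : Set (Fin 3 → X)) ∧
    TriangleDissection.IsDissection TriangleDissection.bigTriangle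
      (TriangleDissection.cellTriangle v '' (T.tri : Set (Fin 3 → X))) ∧
    TriangleDissection.IsSeparated
      (TriangleDissection.cellTriangle v '' (T.tri : Set (Fin 3 → X))) := by
  have h := LatinBitrade.isLevelled_levels ha hv hsep
  have heq : Set.EqOn (cellTriangle v) (fun c => cell (LatinBitrade.lev (LatinBitrade.levels v) c))
      (T.tri : Set (Fin 3 → X)) :=
    fun c hc => LatinBitrade.cellTriangle_eq_cell (h.excess_ne_zero hc)
  rw [heq.image_eq]
  exact ⟨fun w hw => hT.1.solution_unique ha hv hw, h.injOn_cell.congr heq.symm, h.isDissection,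
    h.isSeparated hT⟩
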